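/- Let $d \ge 0$ be an integer and $0 \le \rho < 1$. Let $u, \hat u$ be $\rho$-correlated standard Gaussian vectors in $\mathbb{R}^d$, i.e. the pairs $(u_i, \hat u_i)$, $1 \le i \le d$, are independent and each is a centred bivariate normal with covariance matrix $\begin{pmatrix} 1 & \rho \\ \rho & 1 \end{pmatrix}$. Let $A \subseteq \mathbb{R}^d$ be a measurable set of standard Gaussian measure $\delta > 0$. Then for every $\varepsilon > 0$, $$\Pr_{u}\Bigl[\,\Pr\bigl[\hat u \in A \mid u\bigr] < (\varepsilon\delta)^{1/(1-\rho)}\Bigr] < \varepsilon .$$ In particular, with probability at least $1-\varepsilon$ over $u$, the conditional probability given $u$ that $\hat u \in A$ is at least $(\varepsilon\delta)^{1/(1-\rho)}$. -/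

import Mathlib

open MeasureTheory ProbabilityTheory

/-- Random vectors `u`, `v` in `ℝ^d`, on a probability space `(Ω, P)`, are `ρ`-correlated standard
Gaussians: the coordinate pairs `(u_i, v_i)` are independent over `i`, and each is a centred
bivariate normal with unit variances and covariance `ρ`. -/
structure IsCorrelatedGaussian {Ω : Type*} [MeasurableSpace Ω] {d : ℕ} (ρ : ℝ)
    (u v : Ω → EuclideanSpace ℝ (Fin d)) (P : Measure Ω) : Prop where
  indep : iIndepFun (fun (i : Fin d) (ω : Ω) ↦ (!₂[u ω i, v ω i] : EuclideanSpace ℝ (Fin 2))) P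
  law : ∀ i : Fin d, HasLaw (fun ω ↦ (!₂[u ω i, v ω i] : EuclideanSpace ℝ (Fin 2)))
    (multivariateGaussian 0 !![1, ρ; ρ, 1]) P

open scoped RealInnerProductSpace

/-! Put a = 1/(1-ρ), so that a - 1 = ρa. The heart is reverse hypercontractivity for sets, P(u ∈ B,
v ∈ A) ≥ (P(u ∈ B) P(v ∈ A))^a (`IsCorrelatedGaussian.rpow_mul_rpow_le`). Let B be the set of values
of u at which the conditional probability of A is below t = (εδ)^a. If P(u ∈ B) ≥ ε, the joint
probability is at least t, whereas integrating the conditional probability over B gives strictly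
less than t.

The set inequality comes, by approximating indicators, from E[f(u)^a g(v)^a] ≥ (E f(u))^a (E g(v))^a
for smooth f, g with values in [m, 1], m > 0. That inequality is infinitesimal. The Gaussian (u, v)
is a sum of n independent copies scaled by s = 1/√n. In one such step z^a is expanded to second
order at the means c, e of f, g: the linear terms average out, and a - 1 = ρa makes the quadratic
term a positive multiple of ρ‖Df/c + Dg/e‖² ≥ 0, up to O(s³) (`exists_gaussian_step`). The error
constant is uniform over a class stable under averaging translates (`HasBoundedGradient.average`),
so n steps cost O(n s³) = O(1/√n), which vanishes. -/

/-! ### Taylor expansion of powers and of their products -/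

/-- Second-order Taylor expansion with cubic error on an interval, at an arbitrary base point. -/
theorem abs_sub_taylor_two_le {f f₁ f₂ f₃ : ℝ → ℝ} {l r K : ℝ}
    (h₁ : ∀ z ∈ Set.Icc l r, HasDerivAt f (f₁ z) z)
    (h₂ : ∀ z ∈ Set.Icc l r, HasDerivAt f₁ (f₂ z) z)
    (h₃ : ∀ z ∈ Set.Icc l r, HasDerivAt f₂ (f₃ z) z)
    (hK : ∀ z ∈ Set.Icc l r, |f₃ z| ≤ K) {c z : ℝ} (hc : c ∈ Set.Icc l r) (hz : z ∈ Set.Icc l r) :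
    |f z - (f c + f₁ c * (z - c) + f₂ c / 2 * (z - c) ^ 2)| ≤ K * |z - c| ^ 3 := by
  have hsub : ∀ {z}, z ∈ Set.Icc l r → Set.uIcc c z ⊆ Set.Icc l r := fun hz ↦
    Set.uIcc_subset_Icc hc hz
  have hK0 : 0 ≤ K := (abs_nonneg _).trans (hK c hc)
  have hle : ∀ {y z : ℝ}, y ∈ Set.uIcc c z → |y - c| ≤ |z - c| := fun hy ↦
    Set.abs_sub_left_of_mem_uIcc hy
  -- Mean value inequality between c and z. It is used for `f₂`, then for the first-order remainder
  -- of `f₁`, then for the second-order remainder of `f`; each use gains one factor |z - c|.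
  have key : ∀ {g g' : ℝ → ℝ} {M : ℝ} {z : ℝ}, (∀ y ∈ Set.uIcc c z, HasDerivAt g (g' y) y) →
      (∀ y ∈ Set.uIcc c z, |g' y| ≤ M) → |g z - g c| ≤ M * |z - c| := by
    intro g g' M z hg hM
    exact (convex_uIcc c z).norm_image_sub_le_of_norm_hasDerivWithin_le
      (fun y hy ↦ (hg y hy).hasDerivWithinAt) hM Set.left_mem_uIcc Set.right_mem_uIcc
  have s₂ : ∀ z ∈ Set.Icc l r, |f₂ z - f₂ c| ≤ K * |z - c| := fun z hz ↦
    key (fun y hy ↦ h₃ y (hsub hz hy)) (fun y hy ↦ hK y (hsub hz hy))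
  have s₁ : ∀ z ∈ Set.Icc l r, |f₁ z - f₁ c - f₂ c * (z - c)| ≤ K * |z - c| * |z - c| := by
    intro z hz
    have := key (g := fun y ↦ f₁ y - f₁ c - f₂ c * (y - c)) (g' := fun y ↦ f₂ y - f₂ c)
      (M := K * |z - c|) (z := z) (fun y hy ↦ by
        have h := ((h₂ y (hsub hz hy)).sub_const (f₁ c)).fun_sub
          (((hasDerivAt_id' y).sub_const c).const_mul (f₂ c))
        rwa [mul_one] at h)
      (fun y hy ↦ (s₂ y (hsub hz hy)).trans (mul_le_mul_of_nonneg_left (hle hy) hK0))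
    simpa using this
  have := key (g := fun y ↦ f y - (f c + f₁ c * (y - c) + f₂ c / 2 * (y - c) ^ 2))
    (g' := fun y ↦ f₁ y - f₁ c - f₂ c * (y - c))
      (M := K * |z - c| * |z - c|) (z := z) (fun y hy ↦ by
        have h := (h₁ y (hsub hz hy)).fun_sub ((((hasDerivAt_id' y).sub_const c).const_mul
          (f₁ c)).const_add (f c) |>.fun_add ((((hasDerivAt_id' y).sub_const c).fun_pow 2).const_mul
            (f₂ c / 2)))
        have e : f₁ y - f₁ c - f₂ c * (y - c) = f₁ y - (f₁ c * 1 +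
            f₂ c / 2 * (((2 : ℕ) : ℝ) * (y - c) ^ (2 - 1) * 1)) := by
          push_cast
          ring
        rw [e]
        exact h)
      (fun y hy ↦ (s₁ y (hsub hz hy)).trans (by have := hle hy; gcongr))
  calc _ ≤ K * |z - c| * |z - c| * |z - c| := by simpa using this
    _ = _ := by ring

/-- Uniform second-order expansion of a power on `[m, 1]`. -/
theorem exists_abs_rpow_sub_taylor_le (a : ℝ) {m : ℝ} (hm : 0 < m) :
    ∃ K, ∀ c ∈ Set.Icc m 1, ∀ z ∈ Set.Icc m 1,
      |z ^ a - (c ^ a + a * c ^ (a - 1) * (z - c) + a * (a - 1) / 2 * c ^ (a - 2) * (z - c) ^ 2)|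
        ≤ K * |z - c| ^ 3 := by
  have hpos : ∀ z ∈ Set.Icc m 1, z ≠ 0 := fun z hz ↦ (hm.trans_le hz.1).ne'
  obtain ⟨K, hK⟩ := (isCompact_Icc (a := m) (b := 1)).exists_bound_of_continuousOn
    (f := fun z : ℝ ↦ a * ((a - 1) * ((a - 2) * z ^ (a - 3))))
    (by
      refine ContinuousOn.mul (by fun_prop) (ContinuousOn.mul (by fun_prop)
        (ContinuousOn.mul (by fun_prop) ?_))
      exact ContinuousOn.rpow_const (by fun_prop) fun z hz ↦ Or.inl (hpos z hz))
  refine ⟨K, fun c hc z hz ↦ ?_⟩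
  have := abs_sub_taylor_two_le (f := fun z ↦ z ^ a) (f₁ := fun z ↦ a * z ^ (a - 1))
    (f₂ := fun z ↦ a * ((a - 1) * z ^ (a - 2)))
    (f₃ := fun z : ℝ ↦ a * ((a - 1) * ((a - 2) * z ^ (a - 3)))) (l := m) (r := 1) (K := K)
    (fun z hz ↦ Real.hasDerivAt_rpow_const (Or.inl (hpos z hz)))
    (fun z hz ↦ by
      have := (Real.hasDerivAt_rpow_const (p := a - 1) (Or.inl (hpos z hz))).const_mul a
      rwa [show a - 1 - 1 = a - 2 by ring] at this)
    (fun z hz ↦ by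
      have := ((Real.hasDerivAt_rpow_const (p := a - 2)
        (Or.inl (hpos z hz))).const_mul (a - 1)).const_mul a
      rwa [show a - 2 - 1 = a - 3 by ring] at this) hK hc hz
  convert this using 3
  ring

/-- Expansion of a product of two expanded factors, in terms of the linear parts `s * p` and
`s * q` of the increments `U` and `V`. -/
theorem le_mul_of_expansions {K D : ℝ} (hK : 1 ≤ K) (hD : 0 ≤ D)
    {s T α β γ α' β' γ' U V p q x y : ℝ} (hs0 : 0 ≤ s) (hs1 : s ≤ 1) (hT : 1 ≤ T)
    (hα : |α| ≤ K) (hβ : |β| ≤ K) (hγ : |γ| ≤ K) (hα' : |α'| ≤ K) (hβ' : |β'| ≤ K) (hγ' : |γ'| ≤ K)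
    (hU : |U| ≤ 1) (hy : |y| ≤ 1)
    (hx' : |x - (α + β * U + γ * U ^ 2)| ≤ K * |U| ^ 3)
    (hy' : |y - (α' + β' * V + γ' * V ^ 2)| ≤ K * |V| ^ 3)
    (hp : |p| ≤ D * T) (hq : |q| ≤ D * T)
    (hUp : |U - s * p| ≤ D * s ^ 2 * T) (hVq : |V - s * q| ≤ D * s ^ 2 * T) :
    α * α' + (α * β' * V + α' * β * U)
        + s ^ 2 * (α * γ' * q ^ 2 + β * β' * (p * q) + α' * γ * p ^ 2)
      - (56 * K ^ 2 * D ^ 3 + 12 * K ^ 2 * D ^ 2) * (s ^ 3 * T ^ 3) ≤ x * y := by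
  have hK0 : 0 ≤ K := by linarith
  have hT0 : 0 ≤ T := by linarith
  -- R bounds both |U| and |V|: the linear part and its error are each at most D s T, because s ≤ 1.
  obtain ⟨R, hR⟩ : ∃ R, R = 2 * D * s * T := ⟨_, rfl⟩
  have hR0 : 0 ≤ R := by rw [hR]; positivity
  have hsp : |s * p| ≤ D * s * T := by
    rw [abs_mul, abs_of_nonneg hs0]; nlinarith
  have hsq : |s * q| ≤ D * s * T := by
    rw [abs_mul, abs_of_nonneg hs0]; nlinarith
  have hDs : D * s ^ 2 * T ≤ D * s * T := by
    have : s ^ 2 ≤ s := by nlinarith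
    gcongr
  have hDR : D * s * T ≤ R := by
    have : 0 ≤ D * s * T := by positivity
    rw [hR]; linarith
  have hUR : |U| ≤ R := by
    calc |U| = |(U - s * p) + s * p| := by ring_nf
      _ ≤ _ := abs_add_le _ _
      _ ≤ R := by rw [hR]; linarith
  have hVR : |V| ≤ R := by
    calc |V| = |(V - s * q) + s * q| := by ring_nf
      _ ≤ _ := abs_add_le _ _
      _ ≤ R := by rw [hR]; linarith
  have mul3 : ∀ {a b c a' b' c' : ℝ}, |a| ≤ a' → |b| ≤ b' → |c| ≤ c' →
      |a * b * c| ≤ a' * b' * c' := by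
    intro a b c a' b' c' h1 h2 h3
    rw [abs_mul, abs_mul]
    have := (abs_nonneg a).trans h1
    have := (abs_nonneg b).trans h2
    gcongr
  have mul2 : ∀ {a b a' b' : ℝ}, |a| ≤ a' → |b| ≤ b' → |a * b| ≤ a' * b' := by
    intro a b a' b' h1 h2
    rw [abs_mul]
    have := (abs_nonneg a).trans h1
    gcongr
  have hU3 : |U| ^ 3 ≤ R ^ 3 := by gcongr
  have hV3 : |V| ^ 3 ≤ R ^ 3 := by gcongr
  have hUV : |U * V| ≤ R * R := mul2 hUR hVR
  have hpU : |α + β * U + γ * U ^ 2| ≤ 3 * K := by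
    have h1 := mul2 hβ hU
    have h2 := mul3 hγ hU hU
    calc |α + β * U + γ * U ^ 2| = |α + β * U + γ * U * U| := by ring_nf
      _ ≤ |α| + |β * U| + |γ * U * U| := abs_add_three _ _ _
      _ ≤ _ := by linarith
  -- The nine errors: `e1` and `e2` are the cubic remainders, `e3` to `e5` the products of degree at
  -- least three, and `e6` to `e9` the cost of replacing U, V by s p, s q in the quadratic terms.
  have e1 : |(x - (α + β * U + γ * U ^ 2)) * y| ≤ K * R ^ 3 * 1 :=
    mul2 (hx'.trans (by gcongr)) hy
  have e2 : |(α + β * U + γ * U ^ 2) * (y - (α' + β' * V + γ' * V ^ 2))| ≤ 3 * K * (K * R ^ 3) :=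
    mul2 hpU (hy'.trans (by gcongr))
  have e3 : |β * γ' * (U * V * V)| ≤ K * K * (R * R * R) := mul3 hβ hγ' (mul3 hUR hVR hVR)
  have e4 : |γ * β' * (U * U * V)| ≤ K * K * (R * R * R) := mul3 hγ hβ' (mul3 hUR hUR hVR)
  have e5 : |γ * γ' * (U * V * (V * U))| ≤ K * K * (R * R * (R * 1)) :=
    mul3 hγ hγ' (mul3 hUR hVR (mul2 hVR hU))
  have e6 : |α * γ' * ((V - s * q) * (V + s * q))| ≤ K * K * (D * s ^ 2 * T * (R + R)) :=
    mul3 hα hγ' (mul2 hVq ((abs_add_le _ _).trans (add_le_add hVR (hsq.trans hDR))))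
  have e7 : |α' * γ * ((U - s * p) * (U + s * p))| ≤ K * K * (D * s ^ 2 * T * (R + R)) :=
    mul3 hα' hγ (mul2 hUp ((abs_add_le _ _).trans (add_le_add hUR (hsp.trans hDR))))
  have e8 : |β * β' * ((U - s * p) * V)| ≤ K * K * (D * s ^ 2 * T * R) :=
    mul3 hβ hβ' (mul2 hUp hVR)
  have e9 : |β * β' * ((s * p) * (V - s * q))| ≤ K * K * (R * (D * s ^ 2 * T)) :=
    mul3 hβ hβ' (mul2 (hsp.trans hDR) hVq)
  -- `e1` to `e5` contribute 1 + 3 + 1 + 1 + 1 = 7 multiples of K²R³, and `e6` to `e9` contribute 2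
  -- + 2 + 1 + 1 = 6 multiples of K²·D s²T·R. With R = 2DsT these give 56 and 12.
  have hfin : 7 * K ^ 2 * R ^ 3 + 6 * K ^ 2 * (D * s ^ 2 * T * R) ≤
      (56 * K ^ 2 * D ^ 3 + 12 * K ^ 2 * D ^ 2) * (s ^ 3 * T ^ 3) := by
    have hT2 : T ^ 2 ≤ T ^ 3 := pow_le_pow_right₀ hT (by norm_num)
    have : 12 * K ^ 2 * D ^ 2 * s ^ 3 * T ^ 2 ≤ 12 * K ^ 2 * D ^ 2 * s ^ 3 * T ^ 3 := by gcongr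
    rw [hR]
    linarith
  have hKK : K * R ^ 3 ≤ K ^ 2 * R ^ 3 := by
    gcongr; nlinarith
  have hexp : x * y = α * α' + (α * β' * V + α' * β * U)
        + s ^ 2 * (α * γ' * q ^ 2 + β * β' * (p * q) + α' * γ * p ^ 2)
      + ((x - (α + β * U + γ * U ^ 2)) * y
        + (α + β * U + γ * U ^ 2) * (y - (α' + β' * V + γ' * V ^ 2))
        + β * γ' * (U * V * V) + γ * β' * (U * U * V) + γ * γ' * (U * V * (V * U))
        + α * γ' * ((V - s * q) * (V + s * q)) + α' * γ * ((U - s * p) * (U + s * p))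
        + β * β' * ((U - s * p) * V) + β * β' * ((s * p) * (V - s * q))) := by ring
  rw [hexp]
  rw [abs_le] at e1 e2 e3 e4 e5 e6 e7 e8 e9
  linarith [e1.1, e2.1, e3.1, e4.1, e5.1, e6.1, e7.1, e8.1, e9.1]

/-! ### The one-step inequality -/

/-- One small step: if `X` and `Y` are `[m, 1]`-valued with linear parts `s * p` and `s * q` whose
second moments satisfy the correlation inequality `hQ`, then `X ^ a * Y ^ a` has expectation at
least `E[X] ^ a * E[Y] ^ a`, up to an error of order `s ^ 3`. -/
theorem exists_rpow_mul_rpow_integral_sub_le {W : Type*} [MeasurableSpace W] (κ : Measure W)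
    [IsProbabilityMeasure κ] {a ρ m D : ℝ} (ha : 1 ≤ a) (haρ : a - 1 = ρ * a) (hm : 0 < m)
    (hD : 0 ≤ D) {T : W → ℝ} (hT : ∀ w, 1 ≤ T w)
    (hT3 : Integrable (fun w ↦ T w ^ 3) κ) :
    ∃ C, 0 ≤ C ∧ ∀ (s : ℝ) (X Y p q : W → ℝ), 0 ≤ s → s ≤ 1 →
      AEStronglyMeasurable X κ → AEStronglyMeasurable Y κ →
      AEStronglyMeasurable p κ → AEStronglyMeasurable q κ →
      (∀ w, X w ∈ Set.Icc m 1) → (∀ w, Y w ∈ Set.Icc m 1) →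
      (∀ w, |p w| ≤ D * T w) → (∀ w, |q w| ≤ D * T w) →
      (∀ w, |X w - ∫ w, X w ∂κ - s * p w| ≤ D * s ^ 2 * T w) →
      (∀ w, |Y w - ∫ w, Y w ∂κ - s * q w| ≤ D * s ^ 2 * T w) →
      (∀ x y, 0 ≤ ρ * (x ^ 2 * ∫ w, p w ^ 2 ∂κ + y ^ 2 * ∫ w, q w ^ 2 ∂κ)
        + 2 * (x * y) * ∫ w, p w * q w ∂κ) →
      (∫ w, X w ∂κ) ^ a * (∫ w, Y w ∂κ) ^ a - C * s ^ 3 ≤ ∫ w, X w ^ a * Y w ^ a ∂κ := by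
  obtain ⟨K₁, hK₁⟩ := exists_abs_rpow_sub_taylor_le a hm
  obtain ⟨K₂, hK₂⟩ := (isCompact_Icc (a := m) (b := 1)).exists_bound_of_continuousOn
    (f := fun z : ℝ ↦ a * (a - 1) / 2 * z ^ (a - 2))
    (ContinuousOn.mul (by fun_prop) (ContinuousOn.rpow_const (by fun_prop) fun z hz ↦
      Or.inl (hm.trans_le hz.1).ne'))
  obtain ⟨K, h1K, haK, h₁K, h₂K⟩ : ∃ K, 1 ≤ K ∧ a ≤ K ∧ K₁ ≤ K ∧ K₂ ≤ K :=
    ⟨max (max a K₁) K₂, by simp [ha], by simp, by simp, by simp⟩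
  obtain ⟨E, hE⟩ : ∃ E, E = 56 * K ^ 2 * D ^ 3 + 12 * K ^ 2 * D ^ 2 := ⟨_, rfl⟩
  have hE0 : 0 ≤ E := by rw [hE]; positivity
  -- The constant does not depend on s, X, Y, p or q; this uniformity is what allows many steps to
  -- be added up.
  refine ⟨E * ∫ w, T w ^ 3 ∂κ, mul_nonneg hE0 (integral_nonneg fun w ↦ by
    have := hT w; simp only [Pi.zero_apply]; positivity), ?_⟩
  intro s X Y p q hs0 hs1 hX hY hp hq hXm hYm hpT hqT hXp hYq hQ
  have hint : ∀ {X : W → ℝ}, AEStronglyMeasurable X κ → (∀ w, X w ∈ Set.Icc m 1) →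
      Integrable X κ ∧ ∫ w, X w ∂κ ∈ Set.Icc m 1 := by
    intro X hX hXm
    have hi : Integrable X κ := Integrable.of_bound hX 1 (ae_of_all _ fun w ↦ by
      rw [Real.norm_eq_abs, abs_of_nonneg (hm.le.trans (hXm w).1)]; exact (hXm w).2)
    refine ⟨hi, ?_, ?_⟩
    · simpa using integral_mono (integrable_const m) hi fun w ↦ (hXm w).1
    · simpa using integral_mono hi (integrable_const 1) fun w ↦ (hXm w).2
  obtain ⟨hXi, hc⟩ := hint hX hXm
  obtain ⟨hYi, he⟩ := hint hY hYm
  set c := ∫ w, X w ∂κ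
  set e := ∫ w, Y w ∂κ
  have hprod : ∀ {p q : W → ℝ}, AEStronglyMeasurable p κ → AEStronglyMeasurable q κ →
      (∀ w, |p w| ≤ D * T w) → (∀ w, |q w| ≤ D * T w) → Integrable (fun w ↦ p w * q w) κ := by
    intro p q hp hq hpT hqT
    refine (hT3.const_mul (D ^ 2)).mono' (hp.mul hq) (ae_of_all _ fun w ↦ ?_)
    rw [Real.norm_eq_abs, abs_mul]
    calc |p w| * |q w| ≤ (D * T w) * (D * T w) := by
          have := hpT w; have := hqT w
          have := (abs_nonneg _).trans (hpT w); gcongr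
      _ = D ^ 2 * T w ^ 2 := by ring
      _ ≤ _ := by gcongr; exacts [hT w, by norm_num]
  have hpp : Integrable (fun w ↦ p w ^ 2) κ := by
    simpa only [sq] using hprod hp hp hpT hpT
  have hqq : Integrable (fun w ↦ q w ^ 2) κ := by
    simpa only [sq] using hprod hq hq hqT hqT
  have hpq := hprod hp hq hpT hqT
  have bnd : ∀ {c : ℝ}, c ∈ Set.Icc m 1 → |c ^ a| ≤ K ∧ |a * c ^ (a - 1)| ≤ K ∧
      |a * (a - 1) / 2 * c ^ (a - 2)| ≤ K := by
    intro c hc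
    have hc0 : 0 ≤ c := hm.le.trans hc.1
    refine ⟨?_, ?_, (hK₂ c hc).trans h₂K⟩
    · rw [abs_of_nonneg (by positivity)]
      exact (Real.rpow_le_one hc0 hc.2 (by linarith)).trans h1K
    · rw [abs_of_nonneg (by positivity)]
      have := Real.rpow_le_one hc0 hc.2 (show 0 ≤ a - 1 by linarith)
      nlinarith
  have hdiff : ∀ {c z : ℝ}, c ∈ Set.Icc m 1 → z ∈ Set.Icc m 1 → |z - c| ≤ 1 := fun hc hz ↦
    abs_le.2 ⟨by linarith [hc.2, hz.1], by linarith [hc.1, hz.2]⟩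
  obtain ⟨hα, hβ, hγ⟩ := bnd hc
  obtain ⟨hα', hβ', hγ'⟩ := bnd he
  have hpow1 : ∀ {z : ℝ}, z ∈ Set.Icc m 1 → |z ^ a| ≤ 1 := fun hz ↦ by
    have h0 := hm.le.trans hz.1
    rw [abs_of_nonneg (by positivity)]
    exact Real.rpow_le_one h0 hz.2 (by linarith)
  have hpt : ∀ w, c ^ a * e ^ a
        + (c ^ a * (a * e ^ (a - 1)) * (Y w - e) + e ^ a * (a * c ^ (a - 1)) * (X w - c))
        + s ^ 2 * (c ^ a * (a * (a - 1) / 2 * e ^ (a - 2)) * q w ^ 2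
          + a * c ^ (a - 1) * (a * e ^ (a - 1)) * (p w * q w)
          + e ^ a * (a * (a - 1) / 2 * c ^ (a - 2)) * p w ^ 2)
        - E * (s ^ 3 * T w ^ 3) ≤ X w ^ a * Y w ^ a := by
    intro w
    rw [hE]
    exact le_mul_of_expansions h1K hD hs0 hs1 (hT w) hα hβ hγ hα' hβ' hγ'
      (hdiff hc (hXm w)) (hpow1 (hYm w))
      ((hK₁ c hc _ (hXm w)).trans (by gcongr))
      ((hK₁ e he _ (hYm w)).trans (by gcongr)) (hpT w) (hqT w) (hXp w) (hYq w)
  have hXYi : Integrable (fun w ↦ X w ^ a * Y w ^ a) κ := by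
    have hpowm : ∀ {X : W → ℝ}, AEStronglyMeasurable X κ →
        AEStronglyMeasurable (fun w ↦ X w ^ a) κ := fun hX ↦
      (hX.aemeasurable.pow_const a).aestronglyMeasurable
    refine Integrable.of_bound ((hpowm hX).mul (hpowm hY)) 1 (ae_of_all _ fun w ↦ ?_)
    rw [Real.norm_eq_abs, abs_mul]
    exact mul_le_one₀ (hpow1 (hXm w)) (abs_nonneg _) (hpow1 (hYm w))
  have hi1 : Integrable (fun w ↦ c ^ a * (a * e ^ (a - 1)) * (Y w - e)) κ :=
    (hYi.sub (integrable_const e)).const_mul _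
  have hi2 : Integrable (fun w ↦ e ^ a * (a * c ^ (a - 1)) * (X w - c)) κ :=
    (hXi.sub (integrable_const c)).const_mul _
  have hi3 := hqq.const_mul (c ^ a * (a * (a - 1) / 2 * e ^ (a - 2)))
  have hi4 := hpq.const_mul (a * c ^ (a - 1) * (a * e ^ (a - 1)))
  have hi5 := hpp.const_mul (e ^ a * (a * (a - 1) / 2 * c ^ (a - 2)))
  have hi6 : Integrable (fun w ↦ E * (s ^ 3 * T w ^ 3)) κ := (hT3.const_mul (s ^ 3)).const_mul E
  have hi12 : Integrable (fun w ↦ c ^ a * (a * e ^ (a - 1)) * (Y w - e)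
      + e ^ a * (a * c ^ (a - 1)) * (X w - c)) κ := hi1.add hi2
  have hi34 : Integrable (fun w ↦ c ^ a * (a * (a - 1) / 2 * e ^ (a - 2)) * q w ^ 2
      + a * c ^ (a - 1) * (a * e ^ (a - 1)) * (p w * q w)) κ := hi3.add hi4
  have hi35 : Integrable (fun w ↦ s ^ 2 * (c ^ a * (a * (a - 1) / 2 * e ^ (a - 2)) * q w ^ 2
      + a * c ^ (a - 1) * (a * e ^ (a - 1)) * (p w * q w)
      + e ^ a * (a * (a - 1) / 2 * c ^ (a - 2)) * p w ^ 2)) κ := (hi34.add hi5).const_mul _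
  have hi02 : Integrable (fun w ↦ c ^ a * e ^ a + (c ^ a * (a * e ^ (a - 1)) * (Y w - e)
      + e ^ a * (a * c ^ (a - 1)) * (X w - c))) κ := (integrable_const _).add hi12
  have hi05 : Integrable (fun w ↦ c ^ a * e ^ a + (c ^ a * (a * e ^ (a - 1)) * (Y w - e)
      + e ^ a * (a * c ^ (a - 1)) * (X w - c)) + s ^ 2 *
      (c ^ a * (a * (a - 1) / 2 * e ^ (a - 2)) * q w ^ 2
      + a * c ^ (a - 1) * (a * e ^ (a - 1)) * (p w * q w)
      + e ^ a * (a * (a - 1) / 2 * c ^ (a - 2)) * p w ^ 2)) κ := hi02.add hi35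
  have hmono := (integral_sub hi05 hi6).symm.trans_le (integral_mono (hi05.sub hi6) hXYi hpt)
  rw [integral_add hi02 hi35,
    integral_add (integrable_const _) hi12, integral_add hi1 hi2, integral_const_mul,
    integral_const_mul, integral_const_mul (s ^ 2), integral_add hi34 hi5,
    integral_add hi3 hi4] at hmono
  simp only [integral_const_mul, integral_const, probReal_univ, smul_eq_mul, one_mul] at hmono
  rw [integral_sub hYi (integrable_const e), integral_sub hXi (integrable_const c)] at hmono
  simp only [integral_const, probReal_univ, smul_eq_mul, one_mul] at hmono
  -- The linear terms vanish because c and e are the means of X and Y.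
  change _ + (_ * (e - e) + _ * (c - c)) + _ - _ ≤ _ at hmono
  have hc0 : 0 < c := hm.trans_le hc.1
  have he0 : 0 < e := hm.trans_le he.1
  -- Pulling out (a²/2) c^(a-2) e^(a-2) and using a - 1 = ρa leaves exactly the form in `hQ` at (e,
  -- c).
  have hquad : 0 ≤ c ^ a * (a * (a - 1) / 2 * e ^ (a - 2)) * ∫ w, q w ^ 2 ∂κ
      + a * c ^ (a - 1) * (a * e ^ (a - 1)) * ∫ w, p w * q w ∂κ
      + e ^ a * (a * (a - 1) / 2 * c ^ (a - 2)) * ∫ w, p w ^ 2 ∂κ := by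
    have hpa : ∀ {c : ℝ}, 0 < c → c ^ a = c ^ (a - 2) * c ^ 2 ∧
        c ^ (a - 1) = c ^ (a - 2) * c := fun {c} hc ↦ by
      constructor
      · rw [← Real.rpow_natCast c 2, ← Real.rpow_add hc]; norm_num
      · rw [← Real.rpow_add_one hc.ne']; ring_nf
    obtain ⟨h1, h2⟩ := hpa hc0
    obtain ⟨h3, h4⟩ := hpa he0
    have h := mul_nonneg (show 0 ≤ a ^ 2 / 2 * (c ^ (a - 2) * e ^ (a - 2)) by positivity) (hQ e c)
    rw [h1, h2, h3, h4, haρ]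
    linarith
  have := mul_nonneg (sq_nonneg s) hquad
  linarith

/-! ### Functions with bounded gradient -/

/-- `f` takes values in `[m, 1]` and has gradient field `D`, bounded by `L`, with a uniform
quadratic error in the first-order expansion. -/
structure HasBoundedGradient {E : Type*} [NormedAddCommGroup E] [InnerProductSpace ℝ E]
    [MeasurableSpace E] (m L : ℝ) (f : E → ℝ) (D : E → E) : Prop where
  measurable : Measurable f
  measurable_grad : Measurable D
  mem_Icc : ∀ x, f x ∈ Set.Icc m 1
  norm_grad_le : ∀ x, ‖D x‖ ≤ L
  abs_sub_le : ∀ x h, |f (x + h) - f x - ⟪D x, h⟫| ≤ L * ‖h‖ ^ 2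

section

variable {E : Type*} [NormedAddCommGroup E] [InnerProductSpace ℝ E] [MeasurableSpace E]

theorem HasBoundedGradient.integrable_comp {m L : ℝ} {f : E → ℝ} {D : E → E}
    (hf : HasBoundedGradient m L f D) (hm : 0 ≤ m) {W : Type*} [MeasurableSpace W]
    (κ : Measure W) [IsProbabilityMeasure κ] {q : W → E} (hq : Measurable q) :
    Integrable (fun w ↦ f (q w)) κ := by
  refine Integrable.of_bound (hf.measurable.comp hq).aestronglyMeasurable 1
    (ae_of_all _ fun w ↦ ?_)
  rw [Real.norm_eq_abs, abs_of_nonneg (hm.trans (hf.mem_Icc _).1)]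
  exact (hf.mem_Icc _).2

variable [BorelSpace E]

/-- The deviation of `f (x + s • q)` from its mean is linear up to a quadratic error. -/
theorem HasBoundedGradient.abs_sub_integral_sub_le {m L : ℝ} {f : E → ℝ} {D : E → E}
    (hf : HasBoundedGradient m L f D) (hm : 0 ≤ m) (hL : 0 ≤ L)
    {W : Type*} [NormedAddCommGroup W] [MeasurableSpace W]
    (κ : Measure W) [IsProbabilityMeasure κ] {q : W → E} (hq : Measurable q)
    (hqW : ∀ w, ‖q w‖ ≤ ‖w‖) (hW : Integrable (fun w ↦ ‖w‖ ^ 2) κ) {x : E}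
    (hqi : Integrable (fun w ↦ ⟪D x, q w⟫) κ) (hq0 : ∫ w, ⟪D x, q w⟫ ∂κ = 0) (s : ℝ) (w : W) :
    |f (x + s • q w) - ∫ w, f (x + s • q w) ∂κ - s * ⟪D x, q w⟫|
      ≤ L * s ^ 2 * (1 + ‖w‖ ^ 2 + ∫ w, ‖w‖ ^ 2 ∂κ) := by
  have hpt : ∀ w, |f (x + s • q w) - f x - s * ⟪D x, q w⟫| ≤ L * s ^ 2 * ‖w‖ ^ 2 := by
    intro w
    have h := hf.abs_sub_le x (s • q w)
    rw [inner_smul_right, norm_smul, mul_pow, Real.norm_eq_abs, sq_abs] at h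
    refine h.trans ?_
    rw [← mul_assoc]
    have := hqW w
    gcongr
  have hi : Integrable (fun w ↦ f (x + s • q w)) κ :=
    hf.integrable_comp hm κ ((hq.const_smul s).const_add x)
  have hi' : Integrable (fun w ↦ f (x + s • q w) - f x) κ := hi.sub (integrable_const _)
  have hmean : |∫ w, f (x + s • q w) ∂κ - f x| ≤ L * s ^ 2 * ∫ w, ‖w‖ ^ 2 ∂κ := by
    have e : ∫ w, f (x + s • q w) ∂κ - f x
        = ∫ w, (f (x + s • q w) - f x - s * ⟪D x, q w⟫) ∂κ := by
      rw [integral_sub hi' (hqi.const_mul s),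
        integral_sub hi (integrable_const _), integral_const_mul, hq0]
      simp
    rw [e, ← integral_const_mul]
    refine (abs_integral_le_integral_abs).trans (integral_mono ?_ (hW.const_mul _) hpt)
    exact (hi'.sub (hqi.const_mul s)).abs
  calc |f (x + s • q w) - ∫ w, f (x + s • q w) ∂κ - s * ⟪D x, q w⟫|
      = |(f (x + s • q w) - f x - s * ⟪D x, q w⟫) - (∫ w, f (x + s • q w) ∂κ - f x)| := by
        ring_nf
    _ ≤ L * s ^ 2 * ‖w‖ ^ 2 + L * s ^ 2 * ∫ w, ‖w‖ ^ 2 ∂κ :=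
        (abs_sub _ _).trans (add_le_add (hpt w) hmean)
    _ ≤ _ := by
        have : 0 ≤ L * s ^ 2 := by positivity
        linarith

variable [FiniteDimensional ℝ E]

/-- The class of functions with bounded gradient is stable under averaging translates. -/
theorem HasBoundedGradient.average {m L : ℝ} {f : E → ℝ} {D : E → E}
    (hf : HasBoundedGradient m L f D) (hm : 0 ≤ m) {W : Type*} [MeasurableSpace W]
    (κ : Measure W) [IsProbabilityMeasure κ] {q : W → E} (hq : Measurable q) :
    HasBoundedGradient m L (fun x ↦ ∫ w, f (x + q w) ∂κ) (fun x ↦ ∫ w, D (x + q w) ∂κ) := by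
  have hmeas : Measurable (fun z : E × W ↦ z.1 + q z.2) := by fun_prop
  have hi : ∀ x, Integrable (fun w ↦ f (x + q w)) κ := fun x ↦
    hf.integrable_comp hm κ (hq.const_add x)
  have hDi : ∀ x, Integrable (fun w ↦ D (x + q w)) κ := fun x ↦
    Integrable.of_bound (hf.measurable_grad.comp (hq.const_add x)).aestronglyMeasurable L
      (ae_of_all _ fun w ↦ hf.norm_grad_le _)
  refine ⟨?_, ?_, fun x ↦ ⟨?_, ?_⟩, fun x ↦ ?_, fun x h ↦ ?_⟩
  · exact ((hf.measurable.comp hmeas).stronglyMeasurable.integral_prod_right').measurable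
  · exact ((hf.measurable_grad.comp hmeas).stronglyMeasurable.integral_prod_right').measurable
  · simpa using integral_mono (integrable_const m) (hi x) fun w ↦ (hf.mem_Icc _).1
  · simpa using integral_mono (hi x) (integrable_const 1) fun w ↦ (hf.mem_Icc _).2
  · simpa using norm_integral_le_of_norm_le_const (μ := κ)
      (ae_of_all _ fun w ↦ hf.norm_grad_le (x + q w))
  · have hin : ⟪∫ w, D (x + q w) ∂κ, h⟫ = ∫ w, ⟪D (x + q w), h⟫ ∂κ := by
      rw [real_inner_comm, ← integral_inner (hDi x)]
      simp_rw [real_inner_comm]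
    have hin' : Integrable (fun w ↦ ⟪D (x + q w), h⟫) κ := (hDi x).inner_const h
    have hi2 : Integrable (fun w ↦ f (x + h + q w) - f (x + q w)) κ := (hi _).sub (hi _)
    rw [hin, ← integral_sub (hi _) (hi _), ← integral_sub hi2 hin', ← Real.norm_eq_abs]
    refine (norm_integral_le_of_norm_le_const (μ := κ) (C := L * ‖h‖ ^ 2)
      (ae_of_all _ fun w ↦ ?_)).trans (by simp)
    have := hf.abs_sub_le (x + q w) h
    rwa [show x + q w + h = x + h + q w by abel] at this

/-! ### Gaussian steps and their iteration -/

theorem integrable_norm_pow_of_isGaussian {W : Type*} [NormedAddCommGroup W] [NormedSpace ℝ W]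
    [CompleteSpace W] [SecondCountableTopology W] [MeasurableSpace W] [BorelSpace W]
    (κ : Measure W) [IsGaussian κ] (n : ℕ) : Integrable (fun w ↦ ‖w‖ ^ n) κ :=
  (IsGaussian.memLp_id κ n (by simp)).integrable_norm_pow'

/-- One small Gaussian step for functions with bounded gradient. -/
theorem exists_gaussian_step (κ : Measure (E × E)) [IsGaussian κ] (hκ : ∫ w, w ∂κ = 0)
    {a ρ m L : ℝ} (hρ : 0 ≤ ρ)
    (h11 : ∀ b, ∫ w, ⟪b, w.1⟫ ^ 2 ∂κ = ‖b‖ ^ 2) (h22 : ∀ b, ∫ w, ⟪b, w.2⟫ ^ 2 ∂κ = ‖b‖ ^ 2)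
    (h12 : ∀ b c, ∫ w, ⟪b, w.1⟫ * ⟪c, w.2⟫ ∂κ = ρ * ⟪b, c⟫)
    (ha : 1 ≤ a) (haρ : a - 1 = ρ * a) (hm : 0 < m) (hL : 0 ≤ L) :
    ∃ C, 0 ≤ C ∧ ∀ (s : ℝ) (f g : E → ℝ) (Df Dg : E → E), 0 ≤ s → s ≤ 1 →
      HasBoundedGradient m L f Df → HasBoundedGradient m L g Dg → ∀ x y,
      (∫ w, f (x + s • w.1) ∂κ) ^ a * (∫ w, g (y + s • w.2) ∂κ) ^ a - C * s ^ 3 ≤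
        ∫ w, f (x + s • w.1) ^ a * g (y + s • w.2) ^ a ∂κ := by
  have hint := integrable_norm_pow_of_isGaussian κ
  obtain ⟨M, hM⟩ : ∃ M, M = ∫ w, ‖w‖ ^ 2 ∂κ := ⟨_, rfl⟩
  have hM0 : 0 ≤ M := hM ▸ integral_nonneg fun w ↦ by positivity
  -- The weight 1 + ‖w‖² + M dominates both ‖w‖, for the linear parts, and the quadratic error of
  -- the deviation from the mean. Its cube involves only finite Gaussian moments.
  have hT3 : Integrable (fun w ↦ (1 + ‖w‖ ^ 2 + M) ^ 3) κ := by
    have e : (fun w : E × E ↦ (1 + ‖w‖ ^ 2 + M) ^ 3) = fun w ↦ (1 + M) ^ 3 +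
        (3 * (1 + M) ^ 2 * ‖w‖ ^ 2 + (3 * (1 + M) * ‖w‖ ^ 4 + ‖w‖ ^ 6)) := by
      ext w; ring
    rw [e]
    exact (integrable_const _).add (((hint 2).const_mul _).add (((hint 4).const_mul _).add
      (hint 6)))
  obtain ⟨C, hC0, hC⟩ := exists_rpow_mul_rpow_integral_sub_le κ ha haρ hm hL
    (T := fun w ↦ 1 + ‖w‖ ^ 2 + M) (fun w ↦ by have := sq_nonneg ‖w‖; linarith) hT3
  refine ⟨C, hC0, fun s f g Df Dg hs0 hs1 hf hg x y ↦ ?_⟩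
  have hdual : ∀ (l : StrongDual ℝ (E × E)), Integrable (fun w ↦ l w) κ ∧ ∫ w, l w ∂κ = 0 :=
    fun l ↦ ⟨IsGaussian.integrable_dual κ l, by rw [IsGaussian.integral_dual, hκ, map_zero]⟩
  obtain ⟨hi1, h01⟩ := hdual ((innerSL ℝ (Df x)).comp (ContinuousLinearMap.fst ℝ E E))
  obtain ⟨hi2, h02⟩ := hdual ((innerSL ℝ (Dg y)).comp (ContinuousLinearMap.snd ℝ E E))
  have hlin : ∀ {D : E → E} {f : E → ℝ} (x : E), HasBoundedGradient m L f D →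
      ∀ v : E, ∀ w : E × E, ‖v‖ ≤ ‖w‖ → |⟪D x, v⟫| ≤ L * (1 + ‖w‖ ^ 2 + M) := by
    intro D f x hf v w hv
    refine (abs_real_inner_le_norm _ _).trans ?_
    have := hf.norm_grad_le x
    have : ‖w‖ ≤ 1 + ‖w‖ ^ 2 + M := by nlinarith
    have := hv.trans this
    gcongr
  refine hC s _ _ (fun w ↦ ⟪Df x, w.1⟫) (fun w ↦ ⟪Dg y, w.2⟫) hs0 hs1
    (hf.measurable.comp (by fun_prop)).aestronglyMeasurable
    (hg.measurable.comp (by fun_prop)).aestronglyMeasurable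
    hi1.aestronglyMeasurable hi2.aestronglyMeasurable (fun w ↦ hf.mem_Icc _)
    (fun w ↦ hg.mem_Icc _) (fun w ↦ hlin x hf _ w (norm_fst_le w))
    (fun w ↦ hlin y hg _ w (norm_snd_le w)) (fun w ↦ ?_) (fun w ↦ ?_) (fun b c ↦ ?_)
  · rw [hM]
    exact hf.abs_sub_integral_sub_le hm.le hL κ measurable_fst norm_fst_le (hint 2) hi1 h01 s w
  · rw [hM]
    exact hg.abs_sub_integral_sub_le hm.le hL κ measurable_snd norm_snd_le (hint 2) hi2 h02 s w
  -- With these moments the form is ρ‖b • Df x + c • Dg y‖².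
  · rw [h11, h22, h12]
    have h := norm_add_sq_real (b • Df x) (c • Dg y)
    rw [norm_smul, norm_smul, mul_pow, mul_pow, Real.norm_eq_abs, Real.norm_eq_abs, sq_abs, sq_abs,
      real_inner_smul_left, real_inner_smul_right] at h
    have := mul_nonneg hρ (sq_nonneg ‖b • Df x + c • Dg y‖)
    rw [h] at this
    linarith

/-- A centred Gaussian measure is a convolution of rescaled copies of itself. -/
theorem integral_sqrt_succ_smul_eq {W : Type*} [NormedAddCommGroup W] [NormedSpace ℝ W]
    [CompleteSpace W] [SecondCountableTopology W] [MeasurableSpace W] [BorelSpace W]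
    (κ : Measure W) [IsGaussian κ] (hκ : ∫ w, w ∂κ = 0) (k : ℕ) {Φ : W → ℝ} (hΦ : Measurable Φ)
    {B : ℝ} (hB : ∀ w, |Φ w| ≤ B) :
    ∫ w, Φ (√(k + 1 : ℝ) • w) ∂κ = ∫ w, ∫ w', Φ (√(k : ℝ) • w' + w) ∂κ ∂κ := by
  have hk : (0 : ℝ) < k + 1 := by positivity
  have hk' : √(k + 1 : ℝ) ≠ 0 := (Real.sqrt_pos.2 hk).ne'
  -- A product of two copies of a centred Gaussian is rotation invariant. This angle is chosen so
  -- that √(k+1) (cos θ w' + sin θ w) = √k w' + w.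
  obtain ⟨θ, hcos, hsin⟩ : ∃ θ : ℝ, Real.cos θ = √k / √(k + 1) ∧ Real.sin θ = 1 / √(k + 1) := by
    refine ⟨Real.arcsin (1 / √(k + 1)), ?_, ?_⟩
    · rw [Real.cos_arcsin, ← Real.sqrt_div (by positivity)]
      congr 1
      rw [div_pow, Real.sq_sqrt hk.le]
      field_simp
      ring
    · refine Real.sin_arcsin ?_ ?_
      · have : 0 ≤ 1 / √(k + 1 : ℝ) := by positivity
        linarith
      · rw [div_le_one (Real.sqrt_pos.2 hk)]
        exact Real.one_le_sqrt.2 (by linarith [k.cast_nonneg (α := ℝ)])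
  have hrot := IsGaussian.map_rotation_eq_self (μ := κ) (by simpa using hκ) θ
  have hmp : MeasurePreserving (fun z : W × W ↦ Real.cos θ • z.1 + Real.sin θ • z.2)
      (κ.prod κ) κ := by
    refine measurePreserving_fst.comp (g := Prod.fst)
      (f := ContinuousLinearMap.rotation θ) ⟨by fun_prop, hrot⟩
  have hmap : ∫ w, Φ (√(k + 1 : ℝ) • w) ∂κ = ∫ z : W × W,
      Φ (√(k + 1 : ℝ) • (Real.cos θ • z.1 + Real.sin θ • z.2)) ∂κ.prod κ := by
    conv_lhs => rw [← hmp.map_eq]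
    exact integral_map hmp.measurable.aemeasurable
      (hΦ.comp (measurable_const_smul _)).aestronglyMeasurable
  rw [hmap]
  have e : ∀ z : W × W, √(k + 1 : ℝ) • (Real.cos θ • z.1 + Real.sin θ • z.2)
      = √(k : ℝ) • z.1 + z.2 := fun z ↦ by
    rw [hcos, hsin, smul_add, smul_smul, smul_smul, mul_div_cancel₀ _ hk', mul_div_cancel₀ _ hk',
      one_smul]
  simp_rw [e]
  have hi : Integrable (fun z : W × W ↦ Φ (√(k : ℝ) • z.1 + z.2)) (κ.prod κ) :=
    Integrable.of_bound (Measurable.aestronglyMeasurable (by fun_prop)) B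
      (ae_of_all _ fun z ↦ hB _)
  exact integral_prod_symm _ hi

/-- Reverse hypercontractivity for functions with bounded gradient. -/
theorem HasBoundedGradient.rpow_integral_mul_rpow_integral_le (κ : Measure (E × E)) [IsGaussian κ]
    (hκ : ∫ w, w ∂κ = 0) {a ρ m L : ℝ} (hρ : 0 ≤ ρ)
    (h11 : ∀ b, ∫ w, ⟪b, w.1⟫ ^ 2 ∂κ = ‖b‖ ^ 2) (h22 : ∀ b, ∫ w, ⟪b, w.2⟫ ^ 2 ∂κ = ‖b‖ ^ 2)
    (h12 : ∀ b c, ∫ w, ⟪b, w.1⟫ * ⟪c, w.2⟫ ∂κ = ρ * ⟪b, c⟫)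
    (ha : 1 ≤ a) (haρ : a - 1 = ρ * a) (hm : 0 < m) (hL : 0 ≤ L) {f g : E → ℝ} {Df Dg : E → E}
    (hf : HasBoundedGradient m L f Df) (hg : HasBoundedGradient m L g Dg) :
    (∫ w, f w.1 ∂κ) ^ a * (∫ w, g w.2 ∂κ) ^ a ≤ ∫ w, f w.1 ^ a * g w.2 ^ a ∂κ := by
  obtain ⟨C, hC0, hC⟩ := exists_gaussian_step κ hκ hρ h11 h22 h12 ha haρ hm hL
  have hpow : ∀ {D : E → E} {f : E → ℝ}, HasBoundedGradient m L f D → ∀ x,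
      0 ≤ f x ^ a ∧ f x ^ a ≤ 1 := fun hf x ↦ by
    have h0 := hm.le.trans (hf.mem_Icc x).1
    exact ⟨by positivity, Real.rpow_le_one h0 (hf.mem_Icc x).2 (by linarith)⟩
  have hprod : ∀ {Df Dg : E → E} {f g : E → ℝ}, HasBoundedGradient m L f Df →
      HasBoundedGradient m L g Dg → ∀ x y, |f x ^ a * g y ^ a| ≤ 1 := fun hf hg x y ↦ by
    obtain ⟨h1, h2⟩ := hpow hf x
    obtain ⟨h3, h4⟩ := hpow hg y
    rw [abs_of_nonneg (by positivity)]
    exact mul_le_one₀ h2 h3 h4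
  have hone : ∀ {D : E → E} {f : E → ℝ}, HasBoundedGradient m L f D → ∀ x, |f x| ≤ 1 :=
    fun hf x ↦ by
      rw [abs_of_nonneg (hm.le.trans (hf.mem_Icc x).1)]
      exact (hf.mem_Icc x).2
  -- Here √k • w stands for the sum of k independent steps. The induction ranges over all f, g and
  -- base points, so that the hypothesis can be used at points already shifted by one step.
  have key : ∀ (s : ℝ), 0 ≤ s → s ≤ 1 → ∀ (k : ℕ) (f g : E → ℝ) (Df Dg : E → E),
      HasBoundedGradient m L f Df → HasBoundedGradient m L g Dg → ∀ x y,
      (∫ w, f (x + s • √(k : ℝ) • w.1) ∂κ) ^ a * (∫ w, g (y + s • √(k : ℝ) • w.2) ∂κ) ^ a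
        - k * (C * s ^ 3) ≤
      ∫ w, f (x + s • √(k : ℝ) • w.1) ^ a * g (y + s • √(k : ℝ) • w.2) ^ a ∂κ := by
    intro s hs0 hs1 k
    induction k with
    | zero => intro f g Df Dg hf hg x y; simp
    | succ k ih =>
      intro f g Df Dg hf hg x y
      have hfm := hf.measurable
      have hgm := hg.measurable
      have e : ∀ x v w : E, x + s • (√(k : ℝ) • w + v) = x + s • v + s • √(k : ℝ) • w :=
        fun x v w ↦ by rw [smul_add]; abel
      have hf' := hf.average hm.le κ (q := fun w : E × E ↦ s • √(k : ℝ) • w.1) (by fun_prop)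
      have hg' := hg.average hm.le κ (q := fun w : E × E ↦ s • √(k : ℝ) • w.2) (by fun_prop)
      have h1 := integral_sqrt_succ_smul_eq κ hκ k (Φ := fun w ↦ f (x + s • w.1)) (by fun_prop)
        (fun w ↦ hone hf _)
      have h2 := integral_sqrt_succ_smul_eq κ hκ k (Φ := fun w ↦ g (y + s • w.2)) (by fun_prop)
        (fun w ↦ hone hg _)
      have h3 := integral_sqrt_succ_smul_eq κ hκ k
        (Φ := fun w ↦ f (x + s • w.1) ^ a * g (y + s • w.2) ^ a) (by fun_prop)
        (fun w ↦ hprod hf hg _ _)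
      simp only [Prod.smul_fst, Prod.smul_snd, Prod.fst_add, Prod.snd_add, e] at h1 h2 h3
      push_cast
      rw [h1, h2, h3]
      -- The outer step acts on the averages of f and g over the other k steps. They keep the same m
      -- and L, hence the same C.
      have hstep := hC s _ _ _ _ hs0 hs1 hf' hg' x y
      have hm1 := hf'.measurable
      have hm2 := hg'.measurable
      -- The inductive hypothesis at the shifted base points, integrated over the outer step.
      have hmono : ∫ w, ((∫ w', f (x + s • w.1 + s • √(k : ℝ) • w'.1) ∂κ) ^ a *
          (∫ w', g (y + s • w.2 + s • √(k : ℝ) • w'.2) ∂κ) ^ a - k * (C * s ^ 3)) ∂κ ≤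
          ∫ w, ∫ w', f (x + s • w.1 + s • √(k : ℝ) • w'.1) ^ a *
            g (y + s • w.2 + s • √(k : ℝ) • w'.2) ^ a ∂κ ∂κ := by
        refine integral_mono ?_ ?_ fun w ↦ ih f g Df Dg hf hg _ _
        · refine Integrable.sub ?_ (integrable_const _)
          refine Integrable.of_bound (Measurable.aestronglyMeasurable ?_) 1
            (ae_of_all _ fun w ↦ hprod hf' hg' _ _)
          exact ((hm1.comp (by fun_prop : Measurable fun w : E × E ↦ x + s • w.1)).pow_const a).mul
            ((hm2.comp (by fun_prop : Measurable fun w : E × E ↦ y + s • w.2)).pow_const a)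
        · refine Integrable.of_bound (StronglyMeasurable.integral_prod_right'
            (f := fun z : (E × E) × (E × E) ↦ f (x + s • z.1.1 + s • √(k : ℝ) • z.2.1) ^ a *
              g (y + s • z.1.2 + s • √(k : ℝ) • z.2.2) ^ a)
            (Measurable.stronglyMeasurable (by fun_prop))).aestronglyMeasurable 1
            (ae_of_all _ fun w ↦ ?_)
          exact (norm_integral_le_of_norm_le_const (μ := κ)
            (ae_of_all _ fun w' ↦ hprod hf hg _ _)).trans (by simp)
      rw [integral_sub _ (integrable_const _)] at hmono
      · simp only [integral_const, probReal_univ, smul_eq_mul, one_mul] at hmono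
        linarith
      · refine Integrable.of_bound (Measurable.aestronglyMeasurable ?_) 1
          (ae_of_all _ fun w ↦ hprod hf' hg' _ _)
        exact ((hm1.comp (by fun_prop : Measurable fun w : E × E ↦ x + s • w.1)).pow_const a).mul
          ((hm2.comp (by fun_prop : Measurable fun w : E × E ↦ y + s • w.2)).pow_const a)
  have hlim : Filter.Tendsto (fun n : ℕ ↦ (∫ w, f w.1 ∂κ) ^ a * (∫ w, g w.2 ∂κ) ^ a
      - C * (1 / √((n : ℝ) + 1))) Filter.atTop
      (nhds ((∫ w, f w.1 ∂κ) ^ a * (∫ w, g w.2 ∂κ) ^ a - C * 0)) := by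
    refine tendsto_const_nhds.sub (Filter.Tendsto.const_mul _ ?_)
    refine (Filter.Tendsto.comp Real.tendsto_sqrt_atTop
      (Filter.tendsto_atTop_add_const_right _ 1 tendsto_natCast_atTop_atTop)).const_div_atTop 1
  rw [mul_zero, sub_zero] at hlim
  refine le_of_tendsto' hlim fun n ↦ ?_
  have hn : (0 : ℝ) < n + 1 := by positivity
  have hsq : 0 < √((n : ℝ) + 1) := Real.sqrt_pos.2 hn
  -- With n + 1 steps of size 1/√(n+1) the step sum has law κ itself, and the total error is
  -- C/√(n+1).
  have h := key (1 / √((n : ℝ) + 1)) (by positivity) (by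
    rw [div_le_one hsq]
    exact Real.one_le_sqrt.2 (by linarith [n.cast_nonneg (α := ℝ)])) (n + 1) f g Df Dg hf hg 0 0
  push_cast at h
  simp only [smul_smul, one_div_mul_cancel hsq.ne', one_smul, zero_add] at h
  have e : C * (1 / √((n : ℝ) + 1)) = (n + 1) * (C * (1 / √((n : ℝ) + 1)) ^ 3) := by
    have : ((n : ℝ) + 1) = √((n : ℝ) + 1) ^ 2 := (Real.sq_sqrt hn.le).symm
    generalize √((n : ℝ) + 1) = r at *
    rw [this]
    field_simp
  rw [e]
  exact h

end

/-! ### From smooth functions to measurable sets -/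

section

variable {E : Type*} [NormedAddCommGroup E] [InnerProductSpace ℝ E] [MeasurableSpace E]

theorem HasBoundedGradient.mono {m L L' : ℝ} {f : E → ℝ} {D : E → E}
    (hf : HasBoundedGradient m L f D) (h : L ≤ L') : HasBoundedGradient m L' f D :=
  ⟨hf.measurable, hf.measurable_grad, hf.mem_Icc, fun x ↦ (hf.norm_grad_le x).trans h,
    fun x v ↦ (hf.abs_sub_le x v).trans (by gcongr)⟩

variable [FiniteDimensional ℝ E] [BorelSpace E]

/-- The affine change lifts φ to values at least m, away from the singularity of z^a at 0 when m >
0. Compact support makes the derivative bounded and Lipschitz, and the Lipschitz bound gives the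
quadratic error. -/
theorem exists_hasBoundedGradient {φ : E → ℝ} (hφ : ContDiff ℝ 2 φ) (hc : HasCompactSupport φ)
    (h01 : ∀ x, φ x ∈ Set.Icc 0 1) {m : ℝ} (hm0 : 0 ≤ m) (hm1 : m ≤ 1) :
    ∃ L D, 0 ≤ L ∧ HasBoundedGradient m L (fun x ↦ m + (1 - m) * φ x) D := by
  have hd : ContDiff ℝ 1 (fderiv ℝ φ) := hφ.fderiv_right (by norm_num)
  obtain ⟨C₁, hC₁⟩ := hd.continuous.bounded_above_of_compact_support (hc.fderiv ℝ)
  obtain ⟨C₂, hC₂⟩ := hd.lipschitzWith_of_hasCompactSupport (hc.fderiv ℝ) (by norm_num)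
  have hC₁0 : 0 ≤ C₁ := (norm_nonneg _).trans (hC₁ 0)
  have hdiff : Differentiable ℝ φ := hφ.differentiable (by norm_num)
  have hquad : ∀ x h, |φ (x + h) - φ x - fderiv ℝ φ x h| ≤ C₂ * ‖h‖ ^ 2 := by
    intro x h
    have := (convex_closedBall x ‖h‖).norm_image_sub_le_of_norm_fderiv_le' (f := φ) (𝕜 := ℝ)
      (φ := fderiv ℝ φ x) (C := C₂ * ‖h‖) (x := x) (y := x + h) (fun z _ ↦ hdiff z)
      (fun z hz ↦ by
        have h1 := hC₂.dist_le_mul z x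
        rw [dist_eq_norm] at h1
        refine h1.trans ?_
        have := Metric.mem_closedBall.1 hz
        gcongr) (Metric.mem_closedBall_self (norm_nonneg _)) (by simp)
    rw [add_sub_cancel_left] at this
    calc _ ≤ C₂ * ‖h‖ * ‖h‖ := this
      _ = _ := by ring
  have h1m : 0 ≤ 1 - m := by linarith
  refine ⟨C₁ + C₂, fun x ↦ (1 - m) • (InnerProductSpace.toDual ℝ E).symm (fderiv ℝ φ x),
    by positivity, ?_, ?_, fun x ↦ ?_, fun x ↦ ?_, fun x h ↦ ?_⟩
  · have := hφ.continuous
    fun_prop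
  · have := hd.continuous
    exact Continuous.measurable (by fun_prop)
  · obtain ⟨h0, h1⟩ := h01 x
    constructor <;> nlinarith
  · rw [norm_smul, LinearIsometryEquiv.norm_map, Real.norm_eq_abs, abs_of_nonneg h1m]
    have := hC₁ x
    have h2 : (0 : ℝ) ≤ C₂ := C₂.2
    nlinarith [norm_nonneg (fderiv ℝ φ x)]
  · rw [real_inner_smul_left, InnerProductSpace.toDual_symm_apply]
    have e : m + (1 - m) * φ (x + h) - (m + (1 - m) * φ x) - (1 - m) * fderiv ℝ φ x h
        = (1 - m) * (φ (x + h) - φ x - fderiv ℝ φ x h) := by ring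
    rw [e, abs_mul, abs_of_nonneg h1m]
    calc (1 - m) * |φ (x + h) - φ x - fderiv ℝ φ x h| ≤ 1 * (C₂ * ‖h‖ ^ 2) :=
          mul_le_mul (by linarith) (hquad x h) (abs_nonneg _) zero_le_one
      _ ≤ (C₁ + C₂) * ‖h‖ ^ 2 := by rw [one_mul]; gcongr; linarith

/-- A measurable set is approximated in measure by smooth compactly supported functions. -/
theorem exists_contDiff_eq_indicator_off (μ : Measure E) [IsFiniteMeasure μ] {A : Set E}
    (hA : MeasurableSet A) {η : ℝ} (hη : 0 < η) :
    ∃ (φ : E → ℝ) (N : Set E), ContDiff ℝ 2 φ ∧ HasCompactSupport φ ∧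
      (∀ x, φ x ∈ Set.Icc (0 : ℝ) 1) ∧ MeasurableSet N ∧ μ.real N ≤ η ∧
      (∀ x ∈ A, x ∉ N → φ x = 1) ∧ ∀ x ∉ A, x ∉ N → φ x = 0 := by
  have hη2 : ENNReal.ofReal (η / 2) ≠ 0 := by simpa using hη
  obtain ⟨K, hKA, hK, hμK⟩ := hA.exists_isCompact_sdiff_lt (measure_ne_top μ A) hη2
  obtain ⟨U, hAU, hU, -, hμU⟩ := hA.exists_isOpen_sdiff_lt (measure_ne_top μ A) hη2
  -- Intersecting with a bounded neighbourhood of K forces the bump function to have compact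
  -- support.
  have hKB : K ⊆ U ∩ Metric.thickening 1 K :=
    Set.subset_inter (hKA.trans hAU) (Metric.self_subset_thickening one_pos K)
  obtain ⟨φ, hφ, hr, hs, h1⟩ := exists_contMDiff_support_eq_eq_one_iff (modelWithCornersSelf ℝ E)
    (n := 2) (hU.inter Metric.isOpen_thickening) hK.isClosed hKB
  have hcs : HasCompactSupport φ := by
    refine HasCompactSupport.of_support_subset_isCompact (hK.cthickening (r := 1)) ?_
    rw [hs]
    exact Set.inter_subset_right.trans (Metric.thickening_subset_cthickening _ _)
  refine ⟨φ, A \ K ∪ U \ A, hφ.contDiff, hcs, fun x ↦ hr ⟨x, rfl⟩,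
    (hA.diff hK.measurableSet).union (hU.measurableSet.diff hA), ?_, fun x hx hN ↦ ?_,
    fun x hx hN ↦ ?_⟩
  · refine (measureReal_union_le _ _).trans ?_
    have e1 : μ.real (A \ K) ≤ η / 2 := ENNReal.toReal_le_of_le_ofReal (by positivity) hμK.le
    have e2 : μ.real (U \ A) ≤ η / 2 := ENNReal.toReal_le_of_le_ofReal (by positivity) hμU.le
    linarith
  · refine (h1 x).1 (by_contra fun hxK ↦ hN (Or.inl ⟨hx, hxK⟩))
  · by_contra h
    have : x ∈ Function.support φ := h
    rw [hs] at this
    exact hN (Or.inr ⟨this.1, hx⟩)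

/-- Reverse hypercontractivity for sets: correlated Gaussian vectors hit two sets simultaneously
with probability at least a power of the product of the two measures. -/
theorem rpow_measureReal_mul_rpow_measureReal_le (κ : Measure (E × E)) [IsGaussian κ]
    (hκ : ∫ w, w ∂κ = 0) {a ρ : ℝ} (hρ : 0 ≤ ρ)
    (h11 : ∀ b, ∫ w, ⟪b, w.1⟫ ^ 2 ∂κ = ‖b‖ ^ 2) (h22 : ∀ b, ∫ w, ⟪b, w.2⟫ ^ 2 ∂κ = ‖b‖ ^ 2)
    (h12 : ∀ b c, ∫ w, ⟪b, w.1⟫ * ⟪c, w.2⟫ ∂κ = ρ * ⟪b, c⟫)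
    (ha : 1 ≤ a) (haρ : a - 1 = ρ * a) {A B : Set E} (hA : MeasurableSet A)
    (hB : MeasurableSet B) :
    κ.real (Prod.fst ⁻¹' A) ^ a * κ.real (Prod.snd ⁻¹' B) ^ a ≤ κ.real (A ×ˢ B) := by
  have ha0 : a ≠ 0 := by linarith
  have hAm : MeasurableSet (Prod.fst ⁻¹' A : Set (E × E)) := measurable_fst hA
  have hBm : MeasurableSet (Prod.snd ⁻¹' B : Set (E × E)) := measurable_snd hB
  -- Null sets are settled separately, since the approximation needs η below both measures.
  rcases (measureReal_nonneg (μ := κ) (s := Prod.fst ⁻¹' A)).eq_or_lt with h0 | hA0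
  · rw [← h0, Real.zero_rpow ha0, zero_mul]; exact measureReal_nonneg
  rcases (measureReal_nonneg (μ := κ) (s := Prod.snd ⁻¹' B)).eq_or_lt with h0 | hB0
  · rw [← h0, Real.zero_rpow ha0, mul_zero]; exact measureReal_nonneg
  -- The same η is the lower bound of the approximants and the bound on each exceptional set. The
  -- loss 3η is one η for each exceptional set and one for η^a ≤ η, the bound on a factor outside
  -- its set.
  have key : ∀ η : ℝ, 0 < η → η < 1 → η < κ.real (Prod.fst ⁻¹' A) →
      η < κ.real (Prod.snd ⁻¹' B) →
      (κ.real (Prod.fst ⁻¹' A) - η) ^ a * (κ.real (Prod.snd ⁻¹' B) - η) ^ a - 3 * η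
        ≤ κ.real (A ×ˢ B) := by
    intro η hη hη1 hηA hηB
    have : IsFiniteMeasure (κ.map Prod.fst) := inferInstance
    have : IsFiniteMeasure (κ.map Prod.snd) := inferInstance
    obtain ⟨φ, N, hφ, hφc, hφ01, hN, hμN, hφ1, hφ0⟩ :=
      exists_contDiff_eq_indicator_off (κ.map Prod.fst) hA hη
    obtain ⟨ψ, M, hψ, hψc, hψ01, hM, hμM, hψ1, hψ0⟩ :=
      exists_contDiff_eq_indicator_off (κ.map Prod.snd) hB hη
    rw [map_measureReal_apply measurable_fst hN] at hμN
    rw [map_measureReal_apply measurable_snd hM] at hμM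
    obtain ⟨L₁, D₁, hL₁, hf⟩ := exists_hasBoundedGradient hφ hφc hφ01 hη.le hη1.le
    obtain ⟨L₂, D₂, -, hg⟩ := exists_hasBoundedGradient hψ hψc hψ01 hη.le hη1.le
    replace hf := hf.mono (le_max_left L₁ L₂)
    replace hg := hg.mono (le_max_right L₁ L₂)
    have h := hf.rpow_integral_mul_rpow_integral_le κ hκ hρ h11 h22 h12 ha haρ hη
      (hL₁.trans (le_max_left _ _)) hg
    have hNm : MeasurableSet (Prod.fst ⁻¹' N : Set (E × E)) := measurable_fst hN
    have hMm : MeasurableSet (Prod.snd ⁻¹' M : Set (E × E)) := measurable_snd hM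
    have hind : ∀ {S : Set (E × E)}, MeasurableSet S →
        Integrable (S.indicator (1 : E × E → ℝ)) κ := fun hS ↦
      (integrable_const (1 : ℝ)).indicator hS
    have lower : ∀ {q : E × E → E}, Measurable q → ∀ {A N : Set E} {φ : E → ℝ} {D : E → E}
        {L : ℝ}, MeasurableSet (q ⁻¹' A) → MeasurableSet (q ⁻¹' N) → κ.real (q ⁻¹' N) ≤ η →
        (∀ x ∈ A, x ∉ N → φ x = 1) →
        HasBoundedGradient η L (fun x ↦ η + (1 - η) * φ x) D →
        κ.real (q ⁻¹' A) - η ≤ ∫ w, η + (1 - η) * φ (q w) ∂κ := by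
      intro q hq A N φ D L hAm hNm hN hφ1 hf
      have h1 := integral_mono ((hind hAm).sub (hind hNm)) (hf.integrable_comp hη.le κ hq)
        (fun w ↦ ?_)
      · simp only [Pi.sub_apply] at h1
        rw [integral_sub (hind hAm) (hind hNm), integral_indicator_one hAm,
          integral_indicator_one hNm] at h1
        linarith
      · have hpos := hη.le.trans (hf.mem_Icc (q w)).1
        by_cases hwN : q w ∈ N
        · have : (q ⁻¹' A).indicator (1 : E × E → ℝ) w ≤ 1 :=
            Set.indicator_le_self' (fun _ _ ↦ zero_le_one) w
          have hwN' : w ∈ q ⁻¹' N := hwN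
          simp only [Pi.sub_apply, Set.indicator_of_mem hwN', Pi.one_apply] at this ⊢
          linarith
        · have hwN' : w ∉ q ⁻¹' N := hwN
          by_cases hwA : q w ∈ A
          · have hwA' : w ∈ q ⁻¹' A := hwA
            simp [Set.indicator_of_mem hwA', Set.indicator_of_notMem hwN', hφ1 _ hwA hwN]
          · have hwA' : w ∉ q ⁻¹' A := hwA
            simpa [Set.indicator_of_notMem hwA', Set.indicator_of_notMem hwN'] using hpos
    have l1 := lower measurable_fst hAm hNm hμN hφ1 hf
    have l2 := lower measurable_snd hBm hMm hμM hψ1 hg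
    have hle : (κ.real (Prod.fst ⁻¹' A) - η) ^ a * (κ.real (Prod.snd ⁻¹' B) - η) ^ a ≤
        (∫ w, η + (1 - η) * φ w.1 ∂κ) ^ a * (∫ w, η + (1 - η) * ψ w.2 ∂κ) ^ a := by
      have : 0 ≤ κ.real (Prod.fst ⁻¹' A) - η := by linarith
      have : 0 ≤ κ.real (Prod.snd ⁻¹' B) - η := by linarith
      have : 0 ≤ ∫ w, η + (1 - η) * φ w.1 ∂κ := by linarith
      gcongr
    have hpow : ∀ {D : E → E} {f : E → ℝ} {L : ℝ}, HasBoundedGradient η L f D → ∀ x,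
        0 ≤ f x ^ a ∧ f x ^ a ≤ 1 := fun hf x ↦ by
      have h0 := hη.le.trans (hf.mem_Icc x).1
      exact ⟨by positivity, Real.rpow_le_one h0 (hf.mem_Icc x).2 (by linarith)⟩
    have hηa : η ^ a ≤ η := by
      simpa using Real.rpow_le_rpow_of_exponent_ge hη hη1.le ha
    have hpt : ∀ w : E × E, (η + (1 - η) * φ w.1) ^ a * (η + (1 - η) * ψ w.2) ^ a ≤
        (A ×ˢ B).indicator 1 w + η + (Prod.fst ⁻¹' N).indicator 1 w
          + (Prod.snd ⁻¹' M).indicator 1 w := by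
      intro w
      obtain ⟨f0, f1⟩ := hpow hf w.1
      obtain ⟨g0, g1⟩ := hpow hg w.2
      have hnn : ∀ S : Set (E × E), 0 ≤ S.indicator (1 : E × E → ℝ) w := fun S ↦
        Set.indicator_nonneg (fun _ _ ↦ zero_le_one) w
      have n1 := hnn (A ×ˢ B)
      have n2 := hnn (Prod.fst ⁻¹' N)
      have n3 := hnn (Prod.snd ⁻¹' M)
      have p1 := mul_le_one₀ f1 g0 g1
      by_cases hwN : w ∈ Prod.fst ⁻¹' N
      · have : (Prod.fst ⁻¹' N).indicator (1 : E × E → ℝ) w = 1 := Set.indicator_of_mem hwN _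
        linarith
      by_cases hwM : w ∈ Prod.snd ⁻¹' M
      · have : (Prod.snd ⁻¹' M).indicator (1 : E × E → ℝ) w = 1 := Set.indicator_of_mem hwM _
        linarith
      by_cases hwA : w.1 ∈ A
      · by_cases hwB : w.2 ∈ B
        · have : (A ×ˢ B).indicator (1 : E × E → ℝ) w = 1 :=
            Set.indicator_of_mem (Set.mk_mem_prod hwA hwB) _
          linarith
        · have h2 : (η + (1 - η) * φ w.1) ^ a * (η + (1 - η) * ψ w.2) ^ a ≤ 1 * η :=
            mul_le_mul f1 (by rw [hψ0 _ hwB hwM]; simpa using hηa) g0 zero_le_one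
          linarith
      · have h2 : (η + (1 - η) * φ w.1) ^ a * (η + (1 - η) * ψ w.2) ^ a ≤ η * 1 :=
          mul_le_mul (by rw [hφ0 _ hwA hwN]; simpa using hηa) g1 g0 hη.le
        linarith
    have hABm : MeasurableSet (A ×ˢ B) := hA.prod hB
    have i1 : Integrable (fun w ↦ (A ×ˢ B).indicator 1 w + η) κ :=
      (hind hABm).add (integrable_const η)
    have i2 : Integrable (fun w ↦ (A ×ˢ B).indicator 1 w + η
      + (Prod.fst ⁻¹' N).indicator 1 w) κ := i1.add (hind hNm)
    have hup : ∫ w, (η + (1 - η) * φ w.1) ^ a * (η + (1 - η) * ψ w.2) ^ a ∂κ ≤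
        κ.real (A ×ˢ B) + 3 * η := by
      refine (integral_mono_of_nonneg (ae_of_all _ fun w ↦ ?_) (i2.add (hind hMm))
        (ae_of_all _ hpt)).trans ?_
      · exact mul_nonneg (hpow hf w.1).1 (hpow hg w.2).1
      · refine (integral_add i2 (hind hMm)).trans_le ?_
        rw [integral_add i1 (hind hNm), integral_add (hind hABm) (integrable_const η),
          integral_indicator_one hABm, integral_indicator_one hNm, integral_indicator_one hMm]
        simp only [integral_const, probReal_univ, smul_eq_mul, one_mul]
        linarith
    linarith
  have hcont : Filter.Tendsto (fun η : ℝ ↦ (κ.real (Prod.fst ⁻¹' A) - η) ^ a *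
      (κ.real (Prod.snd ⁻¹' B) - η) ^ a - 3 * η) (nhdsWithin 0 (Set.Ioi 0))
      (nhds (κ.real (Prod.fst ⁻¹' A) ^ a * κ.real (Prod.snd ⁻¹' B) ^ a)) := by
    have hc : Continuous (fun η : ℝ ↦ (κ.real (Prod.fst ⁻¹' A) - η) ^ a *
        (κ.real (Prod.snd ⁻¹' B) - η) ^ a - 3 * η) :=
      (((continuous_const.sub continuous_id).rpow_const fun _ ↦ Or.inr (by linarith)).mul
        ((continuous_const.sub continuous_id).rpow_const fun _ ↦ Or.inr (by linarith))).sub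
        (continuous_const.mul continuous_id)
    simpa using (hc.tendsto 0).mono_left nhdsWithin_le_nhds
  refine le_of_tendsto hcont ?_
  filter_upwards [self_mem_nhdsWithin, nhdsWithin_le_nhds (Iio_mem_nhds one_pos),
    nhdsWithin_le_nhds (Iio_mem_nhds hA0), nhdsWithin_le_nhds (Iio_mem_nhds hB0)]
    with η h1 h2 h3 h4 using key η h1 h2 h3 h4

end

/-! ### Moments and laws of correlated Gaussian vectors -/

/-- The quadratic form is ρ(x₀ + x₁)² + (1 - ρ)(x₀² + x₁²). -/
theorem posSemidef_correlation {ρ : ℝ} (h0 : 0 ≤ ρ) (h1 : ρ < 1) :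
    (!![1, ρ; ρ, 1] : Matrix (Fin 2) (Fin 2) ℝ).PosSemidef := by
  refine .of_dotProduct_mulVec_nonneg ?_ fun x ↦ ?_
  · ext i j
    fin_cases i <;> fin_cases j <;> simp
  · simp only [dotProduct, Matrix.mulVec, Fin.sum_univ_two, Pi.star_apply, star_trivial,
      Matrix.of_apply, Matrix.cons_val_zero, Matrix.cons_val_one, Matrix.cons_val']
    simp
    nlinarith [mul_nonneg h0 (sq_nonneg (x 0 + x 1)), mul_nonneg (sub_nonneg.2 h1.le)
      (add_nonneg (sq_nonneg (x 0)) (sq_nonneg (x 1)))]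

namespace IsCorrelatedGaussian

variable {Ω : Type*} [MeasurableSpace Ω] {d : ℕ} {ρ : ℝ} {u v : Ω → EuclideanSpace ℝ (Fin d)}
  {P : Measure Ω}

theorem hasGaussianLaw_pair (h : IsCorrelatedGaussian ρ u v P) (i : Fin d) :
    HasGaussianLaw (fun ω ↦ (!₂[u ω i, v ω i] : EuclideanSpace ℝ (Fin 2))) P :=
  (h.law i).hasGaussianLaw

/-- Independent Gaussian pairs are jointly Gaussian, and (u, v) is a linear rearrangement of their
coordinates. -/
theorem hasGaussianLaw_prod (h : IsCorrelatedGaussian ρ u v P) :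
    HasGaussianLaw (fun ω ↦ (u ω, v ω)) P := by
  have hg := iIndepFun.hasGaussianLaw h.hasGaussianLaw_pair h.indep
  let L (k : Fin 2) : (Fin d → EuclideanSpace ℝ (Fin 2)) →L[ℝ] EuclideanSpace ℝ (Fin d) :=
    (PiLp.continuousLinearEquiv 2 ℝ (fun _ : Fin d ↦ ℝ)).symm.toContinuousLinearMap.comp
      (ContinuousLinearMap.pi fun i ↦ (EuclideanSpace.proj k).comp (ContinuousLinearMap.proj i))
  exact hg.map_fun ((L 0).prod (L 1))

theorem hasGaussianLaw_fst (h : IsCorrelatedGaussian ρ u v P) : HasGaussianLaw u P :=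
  h.hasGaussianLaw_prod.map_fun (ContinuousLinearMap.fst ℝ _ _)

theorem hasGaussianLaw_snd (h : IsCorrelatedGaussian ρ u v P) : HasGaussianLaw v P :=
  h.hasGaussianLaw_prod.map_fun (ContinuousLinearMap.snd ℝ _ _)

/-- Second moments of the coordinates of a family of independent centred Gaussian pairs. -/
theorem integral_coord_mul_coord [IsProbabilityMeasure P] (h : IsCorrelatedGaussian ρ u v P) (hρ0 : 0 ≤ ρ)
    (hρ1 : ρ < 1) (i j : Fin d) (k l : Fin 2) :
    Integrable (fun ω ↦ (!₂[u ω i, v ω i] : EuclideanSpace ℝ (Fin 2)) k *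
      (!₂[u ω j, v ω j] : EuclideanSpace ℝ (Fin 2)) l) P ∧
    ∫ ω, (!₂[u ω i, v ω i] : EuclideanSpace ℝ (Fin 2)) k *
      (!₂[u ω j, v ω j] : EuclideanSpace ℝ (Fin 2)) l ∂P
      = if i = j then (!![1, ρ; ρ, 1] : Matrix (Fin 2) (Fin 2) ℝ) k l else 0 := by
  have hS := posSemidef_correlation hρ0 hρ1
  have hlp : ∀ i k, MemLp (fun ω ↦ (!₂[u ω i, v ω i] : EuclideanSpace ℝ (Fin 2)) k) 2 P :=
    fun i k ↦ ((h.hasGaussianLaw_pair i).map_fun (EuclideanSpace.proj k)).memLp_two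
  have hmean : ∀ i k, ∫ ω, (!₂[u ω i, v ω i] : EuclideanSpace ℝ (Fin 2)) k ∂P = 0 := by
    intro i k
    have h1 := (h.law i).integral_eq
    rw [integral_id_multivariateGaussian] at h1
    have h2 := (EuclideanSpace.proj (𝕜 := ℝ) k).integral_comp_comm
      (h.hasGaussianLaw_pair i).integrable
    rw [h1, map_zero] at h2
    exact h2
  refine ⟨(hlp i k).integrable_mul (hlp j l), ?_⟩
  split_ifs with hij
  · subst hij
    have h1 := (h.law i).covariance_fun_comp (f := fun x ↦ x k) (g := fun x ↦ x l)
      (by fun_prop) (by fun_prop)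
    rw [covariance_eval_multivariateGaussian hS, covariance_eq_sub (hlp i k) (hlp i l), hmean,
      zero_mul, sub_zero] at h1
    exact h1
  · have h1 := (h.indep.indepFun hij).integral_fun_comp_mul_comp (f := fun x ↦ x k)
      (g := fun x ↦ x l) (h.law i).aemeasurable (h.law j).aemeasurable
      (by fun_prop) (by fun_prop)
    rw [hmean, zero_mul] at h1
    exact h1

/-- The indices k and l select u or v, so a single identity supplies all three second-moment
conditions of `rpow_measureReal_mul_rpow_measureReal_le`. -/
theorem integral_inner_mul_inner [IsProbabilityMeasure P] (h : IsCorrelatedGaussian ρ u v P) (hρ0 : 0 ≤ ρ)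
    (hρ1 : ρ < 1) (k l : Fin 2) (b c : EuclideanSpace ℝ (Fin d)) :
    ∫ ω, (∑ i, b i * (!₂[u ω i, v ω i] : EuclideanSpace ℝ (Fin 2)) k) *
      (∑ j, c j * (!₂[u ω j, v ω j] : EuclideanSpace ℝ (Fin 2)) l) ∂P
      = (!![1, ρ; ρ, 1] : Matrix (Fin 2) (Fin 2) ℝ) k l * ⟪b, c⟫ := by
  have e : ∀ ω, (∑ i, b i * (!₂[u ω i, v ω i] : EuclideanSpace ℝ (Fin 2)) k) *
      (∑ j, c j * (!₂[u ω j, v ω j] : EuclideanSpace ℝ (Fin 2)) l) = ∑ i, ∑ j, b i * c j *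
        ((!₂[u ω i, v ω i] : EuclideanSpace ℝ (Fin 2)) k *
          (!₂[u ω j, v ω j] : EuclideanSpace ℝ (Fin 2)) l) := fun ω ↦ by
    rw [Finset.sum_mul_sum]
    exact Finset.sum_congr rfl fun i _ ↦ Finset.sum_congr rfl fun j _ ↦ by ring
  have hi := fun i j ↦ (h.integral_coord_mul_coord hρ0 hρ1 i j k l).1.const_mul (b i * c j)
  simp_rw [e]
  rw [integral_finsetSum _ fun i _ ↦ integrable_finsetSum _ fun j _ ↦ hi i j]
  simp_rw [integral_finsetSum _ fun j _ ↦ hi _ j, integral_const_mul,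
    (h.integral_coord_mul_coord hρ0 hρ1 _ _ k l).2]
  simp [PiLp.inner_apply, Finset.mul_sum, mul_comm]

theorem integral_prod_eq_zero (h : IsCorrelatedGaussian ρ u v P) :
    ∫ w, w ∂(P.map fun ω ↦ (u ω, v ω)) = 0 := by
  have hg := h.hasGaussianLaw_prod
  have hmean : ∀ i, ∫ ω, (!₂[u ω i, v ω i] : EuclideanSpace ℝ (Fin 2)) ∂P = 0 := fun i ↦ by
    simpa using (h.law i).integral_eq
  have hcoord : ∀ i k, ∫ ω, (!₂[u ω i, v ω i] : EuclideanSpace ℝ (Fin 2)) k ∂P = 0 := by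
    intro i k
    have h2 := (EuclideanSpace.proj (𝕜 := ℝ) k).integral_comp_comm
      (h.hasGaussianLaw_pair i).integrable
    rw [hmean, map_zero] at h2
    exact h2
  rw [integral_map hg.aemeasurable (by fun_prop)]
  refine Prod.ext ?_ ?_
  · ext i
    have h1 := ((EuclideanSpace.proj (𝕜 := ℝ) i).comp
      (ContinuousLinearMap.fst ℝ _ _)).integral_comp_comm hg.integrable
    exact h1.symm.trans (hcoord i 0)
  · ext i
    have h1 := ((EuclideanSpace.proj (𝕜 := ℝ) i).comp
      (ContinuousLinearMap.snd ℝ _ _)).integral_comp_comm hg.integrable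
    exact h1.symm.trans (hcoord i 1)

theorem map_snd_eq_stdGaussian [IsProbabilityMeasure P] (h : IsCorrelatedGaussian ρ u v P)
    (hρ0 : 0 ≤ ρ) (hρ1 : ρ < 1) : P.map v = stdGaussian (EuclideanSpace ℝ (Fin d)) := by
  have hS := posSemidef_correlation hρ0 hρ1
  have hlaw : ∀ i, HasLaw (fun ω ↦ v ω i) (gaussianReal 0 1) P := fun i ↦ by
    have := (measurePreserving_eval_multivariateGaussian (μ := 0) hS (i := 1)).comp_hasLaw (h.law i)
    simpa [Function.comp_def] using this
  have hind : iIndepFun (fun i ω ↦ v ω i) P :=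
    h.indep.comp (fun _ x ↦ x 1) fun _ ↦ by fun_prop
  have hpi := (iIndepFun_iff_map_fun_eq_pi_map fun i ↦ (hlaw i).aemeasurable).1 hind
  simp_rw [fun i ↦ (hlaw i).map_eq] at hpi
  rw [← map_pi_eq_stdGaussian, ← hpi, AEMeasurable.map_map_of_aemeasurable (by fun_prop)
    (aemeasurable_pi_lambda _ fun i ↦ (hlaw i).aemeasurable)]
  rfl

/-- Reverse hypercontractivity for correlated Gaussian vectors and measurable sets. -/
theorem rpow_mul_rpow_le [IsProbabilityMeasure P] (h : IsCorrelatedGaussian ρ u v P)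
    (hρ0 : 0 ≤ ρ) (hρ1 : ρ < 1) {A B : Set (EuclideanSpace ℝ (Fin d))} (hA : MeasurableSet A)
    (hB : MeasurableSet B) :
    (P.map u).real A ^ (1 / (1 - ρ)) * (P.map v).real B ^ (1 / (1 - ρ)) ≤
      (P.map fun ω ↦ (u ω, v ω)).real (A ×ˢ B) := by
  have hg := h.hasGaussianLaw_prod
  have := hg.isGaussian_map
  have h1ρ : 0 < 1 - ρ := by linarith
  have hin : ∀ (b c : EuclideanSpace ℝ (Fin d)), ⟪b, c⟫ = ∑ i, b i * c i := fun b c ↦ by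
    simp [PiLp.inner_apply, mul_comm]
  have key := rpow_measureReal_mul_rpow_measureReal_le (P.map fun ω ↦ (u ω, v ω))
    h.integral_prod_eq_zero (a := 1 / (1 - ρ)) hρ0 (fun b ↦ ?_) (fun b ↦ ?_) (fun b c ↦ ?_)
    ?_ ?_ hA hB
  · have e1 : (P.map fun ω ↦ (u ω, v ω)).map Prod.fst = P.map u :=
      Measure.fst_map_prodMk₀ h.hasGaussianLaw_snd.aemeasurable
    have e2 : (P.map fun ω ↦ (u ω, v ω)).map Prod.snd = P.map v :=
      Measure.snd_map_prodMk₀ h.hasGaussianLaw_fst.aemeasurable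
    rwa [← map_measureReal_apply measurable_fst hA, ← map_measureReal_apply measurable_snd hB,
      e1, e2] at key
  · rw [integral_map hg.aemeasurable (by fun_prop), ← real_inner_self_eq_norm_sq]
    have h1 := h.integral_inner_mul_inner hρ0 hρ1 0 0 b b
    simp only [hin, sq] at h1 ⊢
    simpa using h1
  · rw [integral_map hg.aemeasurable (by fun_prop), ← real_inner_self_eq_norm_sq]
    have h1 := h.integral_inner_mul_inner hρ0 hρ1 1 1 b b
    simp only [hin, sq] at h1 ⊢
    simpa using h1
  · rw [integral_map hg.aemeasurable (by fun_prop)]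
    have h1 := h.integral_inner_mul_inner hρ0 hρ1 0 1 b c
    simpa [hin] using h1
  · rw [le_div_iff₀ h1ρ]; linarith
  · field_simp
    ring

end IsCorrelatedGaussian

/-! ### Conditional probabilities -/

theorem mainTheorem6 {Ω : Type*} [MeasurableSpace Ω] (P : Measure Ω) [IsProbabilityMeasure P]
    (d : ℕ) (ρ : ℝ) (hρ0 : 0 ≤ ρ) (hρ1 : ρ < 1)
    (u v : Ω → EuclideanSpace ℝ (Fin d)) (huv : IsCorrelatedGaussian ρ u v P)
    (A : Set (EuclideanSpace ℝ (Fin d)))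
    (hA : NullMeasurableSet A (stdGaussian (EuclideanSpace ℝ (Fin d))))
    (δ : ℝ) (hδ : 0 < δ) (hAδ : (stdGaussian (EuclideanSpace ℝ (Fin d))).real A = δ)
    (ε : ℝ) (hε : 0 < ε) :
    P.real {ω | (condDistrib v u P (u ω)).real A < (ε * δ) ^ (1 / (1 - ρ))} < ε := by
  have hu : AEMeasurable u P := huv.hasGaussianLaw_fst.aemeasurable
  have hv : AEMeasurable v P := huv.hasGaussianLaw_snd.aemeasurable
  have hstd := huv.map_snd_eq_stdGaussian hρ0 hρ1
  have h1ρ : 0 < 1 / (1 - ρ) := by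
    have : 0 < 1 - ρ := by linarith
    positivity
  obtain ⟨A', hA', hAA'⟩ := hA
  obtain ⟨t, ht⟩ : ∃ t, t = (ε * δ) ^ (1 / (1 - ρ)) := ⟨_, rfl⟩
  have ht0 : 0 < t := by rw [ht]; positivity
  let B : Set (EuclideanSpace ℝ (Fin d)) := {x | (condDistrib v u P x).real A' < t}
  have hBm : MeasurableSet B :=
    measurableSet_lt (Kernel.measurable_coe _ hA').ennreal_toReal measurable_const
  -- The law of v is the mixture of the conditional laws, so a set null for it is null for almost
  -- every conditional law. Thus A may be replaced by the measurable A'.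
  have hae : ∀ᵐ ω ∂P, (condDistrib v u P (u ω)).real A = (condDistrib v u P (u ω)).real A' := by
    rw [← hstd, ← condDistrib_comp_map hu hv] at hAA'
    filter_upwards [ae_of_ae_map hu (Measure.ae_ae_of_ae_comp hAA')] with ω hω
    exact measureReal_congr hω
  have hset : P.real {ω | (condDistrib v u P (u ω)).real A < (ε * δ) ^ (1 / (1 - ρ))}
      = (P.map u).real B := by
    rw [map_measureReal_apply_of_aemeasurable hu hBm, ← ht]
    refine measureReal_congr ?_
    filter_upwards [hae] with ω hω
    exact congrArg (· < t) hω
  rw [hset]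
  by_contra! hB
  have : IsProbabilityMeasure (P.map u) := Measure.isProbabilityMeasure_map hu
  have hB0 : P.map u B ≠ 0 := fun h0 ↦ by
    rw [measureReal_def, h0] at hB
    simp at hB
    linarith
  have hδ' : (P.map v).real A' = δ := by
    rw [hstd, ← hAδ]
    exact (measureReal_congr hAA').symm
  have hrev := huv.rpow_mul_rpow_le hρ0 hρ1 hBm hA'
  rw [hδ', ← Real.mul_rpow measureReal_nonneg hδ.le] at hrev
  have hge : t ≤ ((P.map u).real B * δ) ^ (1 / (1 - ρ)) := by
    rw [ht]
    gcongr
  -- Strictness comes from the conditional probability being below t everywhere on B, which has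
  -- positive measure; reverse hypercontractivity gives only the bound ≥ t.
  have hlt : (P.map fun ω ↦ (u ω, v ω)) (B ×ˢ A') < ENNReal.ofReal t := by
    rw [← compProd_map_condDistrib hv, Measure.compProd_apply_prod hBm hA']
    have hle1 : ∫⁻ x in B, condDistrib v u P x A' ∂P.map u ≤ 1 :=
      (lintegral_mono fun _ ↦ prob_le_one).trans (by simpa using prob_le_one)
    calc ∫⁻ x in B, condDistrib v u P x A' ∂P.map u
        < ∫⁻ _ in B, ENNReal.ofReal t ∂P.map u := by
          refine setLIntegral_strict_mono hBm hB0 measurable_const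
            (hle1.trans_lt ENNReal.one_lt_top).ne (ae_of_all _ fun x hx ↦ ?_)
          exact (ENNReal.lt_ofReal_iff_toReal_lt (measure_ne_top _ _)).2 hx
      _ ≤ ENNReal.ofReal t := by
          rw [setLIntegral_const]
          exact mul_le_of_le_one_right' prob_le_one
  have hlt' : (P.map fun ω ↦ (u ω, v ω)).real (B ×ˢ A') < t :=
    (ENNReal.lt_ofReal_iff_toReal_lt hlt.ne_top).1 hlt
  linarith
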